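/- For integers $k\ge 1$ and $n\ge 0$, let $p_{-k}(n)$ denote the number of $k$-colored partitions of $n$, that is, partitions of $n$ in which each part carries one of $k$ colors (equivalently, $\sum_{n\ge0}p_{-k}(n)q^n=\prod_{m\ge1}(1-q^m)^{-k}$). Then for every integer $r\ge 0$, every $k\in\{1,2,6,7,11,17\}$ and every integer $n\ge 0$, $$p_{-(25r+k)}(25n+25-k)\equiv 0\pmod{25}.$$ Moreover, for every integer $n\ge 0$, $$p_{-17}(5n+3)\equiv 0\pmod{25}\quad\text{and}\quad p_{-11}(5n+4)\equiv 0\pmod{25}.$$ -/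

import Mathlib

/-- A `k`-colored partition of `n`: a partition of `n` in which every part carries one of `k` colors.
It is a finite multiset of pairs (size, color) with positive sizes that sum to `n`. -/
@[ext]
structure ColoredPartition (k n : ℕ) where
  /-- the colored parts, as pairs (size, color) -/
  parts : Multiset (ℕ × Fin k)
  /-- all sizes are positive -/
  parts_pos : ∀ a ∈ parts, 0 < a.1
  /-- the sizes sum to `n` -/
  parts_sum : (parts.map Prod.fst).sum = n

/-- There are only finitely many `k`-colored partitions of `n`, so that `Nat.card` below is a
genuine count. -/
instance ColoredPartition.instFinite (k n : ℕ) : Finite (ColoredPartition k n) := by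
  classical
  let B : Multiset (ℕ × Fin k) := n • (Finset.range (n + 1) ×ˢ (Finset.univ : Finset (Fin k))).val
  have hB : ∀ c : ColoredPartition k n, c.parts ≤ B := by
    intro c
    rw [Multiset.le_iff_count]
    intro a
    by_cases ha : a ∈ c.parts
    · have h1 : a.1 ≤ n := by
        rw [← c.parts_sum]
        exact Multiset.le_sum_of_mem (Multiset.mem_map_of_mem Prod.fst ha)
      have h2 : c.parts.card ≤ n := by
        have h := Multiset.card_nsmul_le_sum (s := c.parts.map Prod.fst) (a := 1) (by
          intro x hx
          obtain ⟨b, hb, rfl⟩ := Multiset.mem_map.1 hx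
          exact c.parts_pos b hb)
        simpa [c.parts_sum] using h
      have h3 : Multiset.count a (Finset.range (n + 1) ×ˢ (Finset.univ : Finset (Fin k))).val = 1 := by
        apply Multiset.count_eq_one_of_mem (Finset.nodup _)
        rw [Finset.mem_val, Finset.mem_product, Finset.mem_range]
        exact ⟨by omega, Finset.mem_univ _⟩
      rw [Multiset.count_nsmul, h3, mul_one]
      exact (Multiset.count_le_card _ _).trans h2
    · rw [Multiset.count_eq_zero_of_notMem ha]
      exact Nat.zero_le _
  exact Finite.of_injective (fun c => (⟨c.parts, hB c⟩ : Set.Iic B))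
    (fun c d h => ColoredPartition.ext (congrArg Subtype.val h))

/-- `numColored k n` is the number of `k`-colored partitions of `n`, usually written
`p_{-k}(n)`. -/
noncomputable def numColored (k n : ℕ) : ℕ := Nat.card (ColoredPartition k n)

open PowerSeries
open scoped PowerSeries.WithPiTopology

/-!
Let `E = ∏ (1 - q ^ n)`, so that the generating function of `K`-colored partitions is `E ^ (-K)`
(`coloredSeries_mul_pow`). By the Frobenius congruence, `E ^ 25` is a power series in `q ^ 5`
modulo `25`, hence for `K = 25 r + k` and `N = 25 - k` the series `E ^ (-K)` is `E ^ N` times a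
power series `G` in `q ^ 5` modulo `25` (`dvd_coloredSeries_sub`). Only the part of `E ^ N` with
exponents in the class of `N ≡ -k` modulo `5` matters; call it `B N` (`powPart`).

By the pentagonal number theorem `E = x + y + z`, where the exponents of `x`, `y`, `z` are
congruent to `0`, `1`, `2` modulo `5`. The key relation is `x * z = -y ^ 2`
(`classPart_zero_mul_classPart_two`). It comes from the binary quadratic form
`(6 k - 1) ^ 2 + (6 l - 1) ^ 2`, which governs `pentagonal k + pentagonal l`: the reflection with
matrix `[-3, -4; -4, 3] / 5` preserves the form and reverses the sign `(-1) ^ (k + l)` of the terms.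
It follows that
`E ^ 5 - 5 y E ^ 4 + 15 y ^ 2 E ^ 3 - 25 y ^ 3 E ^ 2 + 25 y ^ 4 E = v`
with `v = x ^ 5 + 11 y ^ 5 + z ^ 5`, a power series in `q ^ 5`. Hence the `B N` satisfy a linear
recurrence of order five with coefficients in `ℤ[v, y]` (`powPart_add_five`). Running it shows
that, modulo `25`, both `B 8` and `B 14` vanish, which settles `k = 17` and `k = 11`, whereas
`B 18`, `B 19`, `B 23`, `B 24` are constant multiples of `5 v ^ 3 y ^ 3`, `5 v ^ 3 y ^ 4`,
`5 v ^ 4 y ^ 3`, `5 v ^ 4 y ^ 4`.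

In the latter cases it remains to work modulo `5`. There `v ≡ E(q ^ 5)`, the factor `G` becomes a
power series in `q ^ 25`, and `y` only has exponents congruent to `1` modulo `25`. So the
coefficients of `q ^ (25 n + N)` in `G * v ^ i * y ^ j`, where `N = 5 i + j`, reduce to coefficients
of `E ^ i` in the class of `i` modulo `5`, up to a factor in `q ^ 5`, and these are divisible by `5`
because `B 3 = -5 y ^ 3` and `B 4 = -5 y ^ 4`.
-/

/-! ### Congruences between integral power series -/

/-- `m` divides all coefficients of a multiple of the constant `m`. -/
theorem dvd_coeff_of_natCast_dvd {m : ℕ} {f : ℤ⟦X⟧} (h : (m : ℤ⟦X⟧) ∣ f) (n : ℕ) :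
    (m : ℤ) ∣ coeff n f := by
  obtain ⟨g, rfl⟩ := h
  rw [← nsmul_eq_mul, map_nsmul, nsmul_eq_mul]
  exact dvd_mul_right _ _

theorem natCast_dvd_of_dvd_coeff {m : ℕ} {f : ℤ⟦X⟧} (h : ∀ n, (m : ℤ) ∣ coeff n f) :
    (m : ℤ⟦X⟧) ∣ f := by
  choose g hg using h
  refine ⟨PowerSeries.mk g, ?_⟩
  ext n
  rw [← nsmul_eq_mul, map_nsmul, nsmul_eq_mul, coeff_mk, hg]

/-- The Frobenius congruence `f(q) ^ p ≡ f(q ^ p)` modulo a prime `p`. -/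
theorem natCast_dvd_pow_sub_expand (p : ℕ) [hp : Fact p.Prime] (f : ℤ⟦X⟧) :
    (p : ℤ⟦X⟧) ∣ f ^ p - expand p hp.out.ne_zero f := by
  refine natCast_dvd_of_dvd_coeff fun n => ?_
  have h : map (Int.castRingHom (ZMod p)) (f ^ p - expand p hp.out.ne_zero f) = 0 := by
    rw [map_sub, map_pow, map_expand]
    have := MvPowerSeries.map_frobenius_expand p hp.out.ne_zero
      (f := map (Int.castRingHom (ZMod p)) f)
    rw [ZMod.frobenius_zmod] at this
    exact sub_eq_zero.2 (this.symm.trans (congrFun (map_id (R := ZMod p)) _))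
  have := congrArg (coeff n) h
  rw [coeff_map] at this
  exact (ZMod.intCast_zmod_eq_zero_iff_dvd _ p).1 this

/-! ### The generating function of colored partitions -/

/-- The generating function of `k`-colored partitions. -/
noncomputable def coloredSeries (k : ℕ) : ℤ⟦X⟧ := .mk fun n => (numColored k n : ℤ)

theorem coloredSeries_zero : coloredSeries 0 = 1 := by
  ext n
  rw [coloredSeries, coeff_mk, coeff_one, numColored]
  split_ifs with h
  · subst h
    have : Unique (ColoredPartition 0 0) :=
      { default := ⟨0, by simp, by simp⟩
        uniq := fun c => by
          ext1
          exact Multiset.eq_zero_of_forall_notMem fun a _ => a.2.elim0 }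
    simp
  · have : IsEmpty (ColoredPartition 0 n) := ⟨fun c => h (by
      rw [← c.parts_sum, Multiset.eq_zero_of_forall_notMem (s := c.parts) fun a _ => a.2.elim0]
      simp)⟩
    simp

/-- The part `a` with its color read in `Fin k`, if that color is not the last one. -/
def dropLastColor (k : ℕ) (a : ℕ × Fin (k + 1)) : Option (ℕ × Fin k) :=
  if h : a.2 = Fin.last k then none else some (a.1, a.2.castPred h)

/-- The size of the part `a`, if `a` has the last color. -/
def sizeOfLastColor (k : ℕ) (a : ℕ × Fin (k + 1)) : Option ℕ :=
  if a.2 = Fin.last k then some a.1 else none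

theorem sum_filterMap_add_sum_filterMap (k : ℕ) (s : Multiset (ℕ × Fin (k + 1))) :
    ((s.filterMap (dropLastColor k)).map Prod.fst).sum + (s.filterMap (sizeOfLastColor k)).sum =
      (s.map Prod.fst).sum := by
  induction s using Multiset.induction with
  | empty => simp
  | cons a s ih =>
    by_cases h : a.2 = Fin.last k
    · simp [dropLastColor, sizeOfLastColor, h, ← ih, add_left_comm]
    · simp [dropLastColor, sizeOfLastColor, h, ← ih, add_assoc]

theorem map_filterMap_add_map_filterMap (k : ℕ) (s : Multiset (ℕ × Fin (k + 1))) :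
    (s.filterMap (dropLastColor k)).map (Prod.map id Fin.castSucc) +
      (s.filterMap (sizeOfLastColor k)).map (fun i => (i, Fin.last k)) = s := by
  induction s using Multiset.induction with
  | empty => simp
  | cons a s ih =>
    obtain ⟨i, c⟩ := a
    by_cases h : c = Fin.last k
    · conv_rhs => rw [← ih]
      simp [dropLastColor, sizeOfLastColor, h]
    · conv_rhs => rw [← ih]
      simp [dropLastColor, sizeOfLastColor, h]

theorem filterMap_const_none {α β : Type*} (s : Multiset α) :
    s.filterMap (fun _ => (none : Option β)) = 0 :=
  Multiset.eq_zero_of_forall_notMem fun b hb => by simp [Multiset.mem_filterMap] at hb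

theorem filterMap_dropLastColor_map_add_map (k : ℕ) (s : Multiset (ℕ × Fin k)) (t : Multiset ℕ) :
    (s.map (Prod.map id Fin.castSucc) + t.map (fun i => (i, Fin.last k))).filterMap
      (dropLastColor k) = s := by
  have h1 : dropLastColor k ∘ Prod.map id Fin.castSucc = some := by
    funext a
    simp [dropLastColor]
  have h2 : (dropLastColor k ∘ fun i : ℕ => (i, Fin.last k)) = fun _ => none := by
    funext a
    simp [dropLastColor]
  rw [Multiset.filterMap_add, Multiset.filterMap_map, Multiset.filterMap_map, h1, h2,
    Multiset.filterMap_some, filterMap_const_none, add_zero]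

theorem filterMap_sizeOfLastColor_map_add_map (k : ℕ) (s : Multiset (ℕ × Fin k))
    (t : Multiset ℕ) :
    (s.map (Prod.map id Fin.castSucc) + t.map (fun i => (i, Fin.last k))).filterMap
      (sizeOfLastColor k) = t := by
  have h1 : sizeOfLastColor k ∘ Prod.map id Fin.castSucc = fun _ => none := by
    funext a
    simp [sizeOfLastColor]
  have h2 : (sizeOfLastColor k ∘ fun i : ℕ => (i, Fin.last k)) = some := by
    funext a
    simp [sizeOfLastColor]
  rw [Multiset.filterMap_add, Multiset.filterMap_map, Multiset.filterMap_map, h1, h2,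
    Multiset.filterMap_some, filterMap_const_none, zero_add]

/-- The pair of a `k`-colored partition with parts `s` and a partition with parts `t`, indexed by
the two numbers that they partition. -/
def coloredPartitionProdMk {k n : ℕ} (s : Multiset (ℕ × Fin k)) (t : Multiset ℕ)
    (hs : ∀ a ∈ s, 0 < a.1) (ht : ∀ i ∈ t, 0 < i) (h : (s.map Prod.fst).sum + t.sum = n) :
    Σ p : Finset.HasAntidiagonal.antidiagonal n, ColoredPartition k p.1.1 × Nat.Partition p.1.2 :=
  ⟨⟨((s.map Prod.fst).sum, t.sum), Finset.HasAntidiagonal.mem_antidiagonal.2 h⟩, ⟨s, hs, rfl⟩,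
    ⟨t, fun {i} hi => ht i hi, rfl⟩⟩

theorem coloredPartitionProdMk_congr {k n : ℕ} {s s' : Multiset (ℕ × Fin k)} {t t' : Multiset ℕ}
    {hs ht h hs' ht' h'} (es : s = s') (et : t = t') :
    coloredPartitionProdMk (n := n) s t hs ht h = coloredPartitionProdMk s' t' hs' ht' h' := by
  subst es et
  rfl

/-- A `(k + 1)`-colored partition amounts to a `k`-colored partition, made of the parts that
avoid the last color, and an ordinary partition, made of the parts of the last color. -/
def coloredPartitionSuccEquiv (k n : ℕ) : ColoredPartition (k + 1) n ≃
    Σ p : Finset.HasAntidiagonal.antidiagonal n,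
      ColoredPartition k p.1.1 × Nat.Partition p.1.2 where
  toFun c := coloredPartitionProdMk (c.parts.filterMap (dropLastColor k))
    (c.parts.filterMap (sizeOfLastColor k))
    (by
      intro a ha
      obtain ⟨b, hb, hab⟩ := (Multiset.mem_filterMap _ _).1 ha
      have := c.parts_pos b hb
      grind [dropLastColor])
    (by
      intro a ha
      obtain ⟨b, hb, hab⟩ := (Multiset.mem_filterMap _ _).1 ha
      have := c.parts_pos b hb
      grind [sizeOfLastColor])
    ((sum_filterMap_add_sum_filterMap k c.parts).trans c.parts_sum)
  invFun x :=
    { parts := x.2.1.parts.map (Prod.map id Fin.castSucc) +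
        x.2.2.parts.map (fun i => (i, Fin.last k))
      parts_pos := by
        intro a ha
        rcases Multiset.mem_add.1 ha with ha | ha
        · obtain ⟨b, hb, rfl⟩ := Multiset.mem_map.1 ha
          exact x.2.1.parts_pos b hb
        · obtain ⟨b, hb, rfl⟩ := Multiset.mem_map.1 ha
          exact x.2.2.parts_pos hb
      parts_sum := by
        rw [← sum_filterMap_add_sum_filterMap, filterMap_dropLastColor_map_add_map,
          filterMap_sizeOfLastColor_map_add_map, x.2.1.parts_sum, x.2.2.parts_sum]
        exact Finset.HasAntidiagonal.mem_antidiagonal.1 x.1.2 }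
  left_inv c := ColoredPartition.ext (map_filterMap_add_map_filterMap k c.parts)
  right_inv := by
    rintro ⟨⟨⟨i, j⟩, h⟩, ⟨s, hs, es⟩, ⟨t, ht, et⟩⟩
    dsimp only at es et
    subst es et
    exact coloredPartitionProdMk_congr (hs' := hs) (ht' := fun i hi => ht hi)
      (h' := Finset.HasAntidiagonal.mem_antidiagonal.1 h)
      (filterMap_dropLastColor_map_add_map k s t) (filterMap_sizeOfLastColor_map_add_map k s t)

theorem coloredSeries_succ (k : ℕ) :
    coloredSeries (k + 1) = coloredSeries k * .mk fun n => (Fintype.card (Nat.Partition n) : ℤ) := by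
  ext n
  rw [coeff_mul, coloredSeries, coloredSeries, coeff_mk, numColored,
    Nat.card_congr (coloredPartitionSuccEquiv k n), Nat.card_sigma]
  simp only [Nat.card_prod, coeff_mk, numColored, Nat.card_eq_fintype_card (α := Nat.Partition _)]
  push_cast
  exact Finset.sum_coe_sort (Finset.HasAntidiagonal.antidiagonal n) fun p =>
    (Nat.card (ColoredPartition k p.1) : ℤ) * (Fintype.card (Nat.Partition p.2) : ℤ)

/-- Euler's product formula for the generating function of partitions. -/
theorem partitionSeries_mul_pentagonalSeries :
    (.mk fun n => (Fintype.card (Nat.Partition n) : ℤ)) * pentagonalSeries ℤ = 1 := by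
  let _ : TopologicalSpace ℤ := ⊥
  have _ : DiscreteTopology ℤ := ⟨rfl⟩
  have h := (Nat.Partition.hasProd_powerSeriesMk_card_restricted ℤ fun _ => True).mul
    (WithPiTopology.hasProd_one_sub_X_pow ℤ)
  have h1 : (fun n => ((Nat.Partition.restricted n fun _ => True).card : ℤ)) =
      fun n => (Fintype.card (Nat.Partition n) : ℤ) := by
    funext n
    simp [Nat.Partition.restricted]
  rw [h1] at h
  have h2 : (fun i : ℕ => (if True then ∑' j : ℕ, (X : ℤ⟦X⟧) ^ ((i + 1) * j) else 1) *
      (1 - X ^ (i + 1))) = fun _ => 1 := by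
    funext i
    rw [if_pos trivial]
    simp only [pow_mul]
    exact WithPiTopology.tsum_pow_mul_one_sub_of_constantCoeff_eq_zero (by simp)
  rw [h2] at h
  exact h.unique hasProd_one

theorem coloredSeries_mul_pow (k : ℕ) : coloredSeries k * pentagonalSeries ℤ ^ k = 1 := by
  induction k with
  | zero => rw [coloredSeries_zero, pow_zero, one_mul]
  | succ k ih =>
    rw [coloredSeries_succ, pow_succ, mul_mul_mul_comm, ih, one_mul,
      partitionSeries_mul_pentagonalSeries]

/-! ### Residue classes of exponents -/

/-- The power series `f` has no exponents outside the residue class `c` modulo `m`. -/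
def SupportedOn (m : ℕ) (c : ZMod m) (f : ℤ⟦X⟧) : Prop :=
  ∀ n : ℕ, (n : ZMod m) ≠ c → coeff n f = 0

/-- The terms of a power series whose exponents lie in the residue class `c` modulo `m`. -/
noncomputable def classPart (m : ℕ) (c : ZMod m) : ℤ⟦X⟧ →+ ℤ⟦X⟧ :=
  AddMonoidHom.mk' (fun f => .mk fun n => if (n : ZMod m) = c then coeff n f else 0) <| by
    intro f g
    ext n
    simp only [coeff_mk, map_add]
    split_ifs <;> simp

theorem coeff_classPart {m : ℕ} (c : ZMod m) (f : ℤ⟦X⟧) (n : ℕ) :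
    coeff n (classPart m c f) = if (n : ZMod m) = c then coeff n f else 0 := by
  rw [classPart, AddMonoidHom.mk'_apply, coeff_mk]

theorem coeff_classPart_self (m : ℕ) (f : ℤ⟦X⟧) (n : ℕ) :
    coeff n (classPart m n f) = coeff n f := by
  rw [coeff_classPart, if_pos rfl]

theorem supportedOn_classPart {m : ℕ} (c : ZMod m) (f : ℤ⟦X⟧) :
    SupportedOn m c (classPart m c f) := fun n hn => by
  rw [coeff_classPart, if_neg hn]

theorem classPart_mul_left {m : ℕ} {c : ZMod m} (d : ZMod m) {f : ℤ⟦X⟧} (hf : SupportedOn m c f)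
    (g : ℤ⟦X⟧) : classPart m (c + d) (f * g) = f * classPart m d g := by
  ext n
  have h : ∀ p ∈ Finset.HasAntidiagonal.antidiagonal n,
      coeff p.1 f * coeff p.2 (classPart m d g) =
        if (n : ZMod m) = c + d then coeff p.1 f * coeff p.2 g else 0 := by
    rintro ⟨i, j⟩ hij
    rw [← Finset.HasAntidiagonal.mem_antidiagonal.1 hij, coeff_classPart, Nat.cast_add]
    by_cases hi : (i : ZMod m) = c
    · simp [hi]
    · simp [hf i hi]
  rw [coeff_classPart, coeff_mul, coeff_mul, Finset.sum_congr rfl h]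
  split_ifs <;> simp

theorem SupportedOn.classPart_eq {m : ℕ} {c : ZMod m} {f : ℤ⟦X⟧} (hf : SupportedOn m c f) :
    classPart m c f = f := by
  ext n
  rw [coeff_classPart]
  split_ifs with h
  · rfl
  · exact (hf n h).symm

theorem SupportedOn.classPart_eq_zero {m : ℕ} {c d : ZMod m} {f : ℤ⟦X⟧} (hf : SupportedOn m c f)
    (h : c ≠ d) : classPart m d f = 0 := by
  ext n
  rw [coeff_classPart, map_zero]
  split_ifs with hn
  · exact hf n (hn ▸ h.symm)
  · rfl

theorem SupportedOn.add {m : ℕ} {c : ZMod m} {f g : ℤ⟦X⟧} (hf : SupportedOn m c f)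
    (hg : SupportedOn m c g) : SupportedOn m c (f + g) := fun n hn => by
  rw [map_add, hf n hn, hg n hn, add_zero]

theorem SupportedOn.mul {m : ℕ} {c d : ZMod m} {f g : ℤ⟦X⟧} (hf : SupportedOn m c f)
    (hg : SupportedOn m d g) : SupportedOn m (c + d) (f * g) := by
  rw [← hg.classPart_eq, ← classPart_mul_left d hf]
  exact supportedOn_classPart _ _

theorem supportedOn_one (m : ℕ) : SupportedOn m 0 1 := fun n hn => by
  rw [coeff_one, if_neg]
  rintro rfl
  exact hn Nat.cast_zero

theorem SupportedOn.pow {m : ℕ} {c : ZMod m} {f : ℤ⟦X⟧} (hf : SupportedOn m c f) (j : ℕ) :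
    SupportedOn m (j * c) (f ^ j) := by
  induction j with
  | zero => simpa using supportedOn_one m
  | succ j ih =>
    rw [pow_succ, Nat.cast_succ, add_one_mul]
    exact ih.mul hf

theorem supportedOn_expand {m : ℕ} (hm : m ≠ 0) (f : ℤ⟦X⟧) : SupportedOn m 0 (expand m hm f) :=
  fun n hn => coeff_expand_of_not_dvd m hm f fun h => hn ((ZMod.natCast_eq_zero_iff n m).2 h)

/-! ### The 5-dissection of Euler's product -/

/-- Euler's product `∏ (1 - q ^ n)`, in its expansion by pentagonal numbers. -/
local notation "𝓔" => pentagonalSeries ℤ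

theorem pentagonal_mod_five (k : ℤ) :
    ((pentagonal k : ℕ) : ZMod 5) = 3 * k * (3 * k - 1) := by
  have := congrArg (Int.cast : ℤ → ZMod 5) (two_mul_natCast_pentagonal k)
  push_cast at this
  have h6 : (6 : ZMod 5) = 1 := rfl
  linear_combination 3 * this - h6 * (pentagonal k : ZMod 5)

theorem abs_le_pentagonal (k : ℤ) : |k| ≤ pentagonal k := by
  have := two_mul_natCast_pentagonal k
  rcases abs_cases k with ⟨h, h0⟩ | ⟨h, h0⟩ <;> rw [h] <;> nlinarith

theorem coeff_pentagonalSeries_eq_sum {n N : ℕ} (h : n ≤ N) :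
    coeff n 𝓔 = ∑ k ∈ Finset.Icc (-N : ℤ) N,
      if pentagonal k = n then ((k.negOnePow : ℤˣ) : ℤ) else 0 := by
  by_cases hn : n ∈ Set.range pentagonal
  · obtain ⟨k, rfl⟩ := hn
    rw [coeff_pentagonalSeries_pentagonal, Finset.sum_eq_single_of_mem k]
    · rw [if_pos rfl, Int.cast_id]
    · have := abs_le.1 ((abs_le_pentagonal k).trans (Int.ofNat_le.2 h))
      exact Finset.mem_Icc.2 this
    · intro b _ hb
      rw [if_neg (fun e => hb (pentagonal_injective e))]
  · rw [coeff_pentagonalSeries_eq_zero ℤ hn, Finset.sum_eq_zero]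
    intro k _
    rw [if_neg fun e => hn ⟨k, e⟩]

/-- The coefficients of a product of two class parts of Euler's product, as a sum over pairs. -/
theorem coeff_classPart_mul_classPart (c d : ZMod 5) (n : ℕ) :
    coeff n (classPart 5 c 𝓔 * classPart 5 d 𝓔) =
      ∑ k ∈ Finset.Icc (-n : ℤ) n, ∑ l ∈ Finset.Icc (-n : ℤ) n,
        if ((pentagonal k : ℕ) : ZMod 5) = c ∧ ((pentagonal l : ℕ) : ZMod 5) = d then
          (if pentagonal k + pentagonal l = n then
            ((k.negOnePow : ℤˣ) : ℤ) * ((l.negOnePow : ℤˣ) : ℤ) else 0) else 0 := by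
  have key (c : ZMod 5) {i : ℕ} (hi : i ≤ n) : coeff i (classPart 5 c 𝓔) =
      ∑ k ∈ Finset.Icc (-n : ℤ) n,
        if ((pentagonal k : ℕ) : ZMod 5) = c ∧ pentagonal k = i then
          ((k.negOnePow : ℤˣ) : ℤ) else 0 := by
    rw [coeff_classPart, coeff_pentagonalSeries_eq_sum hi]
    split_ifs with h
    · refine Finset.sum_congr rfl fun k _ => ?_
      by_cases hk : pentagonal k = i
      · simp [hk, h]
      · simp [hk]
    · rw [Finset.sum_eq_zero]
      intro k _
      rw [if_neg]
      rintro ⟨h1, rfl⟩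
      exact h h1
  rw [coeff_mul]
  have hterm : ∀ p ∈ Finset.HasAntidiagonal.antidiagonal n,
      coeff p.1 (classPart 5 c 𝓔) * coeff p.2 (classPart 5 d 𝓔) =
        ∑ k ∈ Finset.Icc (-n : ℤ) n, ∑ l ∈ Finset.Icc (-n : ℤ) n,
          (if ((pentagonal k : ℕ) : ZMod 5) = c ∧ pentagonal k = p.1 then
            ((k.negOnePow : ℤˣ) : ℤ) else 0) *
          (if ((pentagonal l : ℕ) : ZMod 5) = d ∧ pentagonal l = p.2 then
            ((l.negOnePow : ℤˣ) : ℤ) else 0) := by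
    intro p hp
    have := Finset.HasAntidiagonal.mem_antidiagonal.1 hp
    rw [key c (by omega : p.1 ≤ n), key d (by omega : p.2 ≤ n), Finset.sum_mul_sum]
  rw [Finset.sum_congr rfl hterm]
  rw [Finset.sum_comm]
  refine Finset.sum_congr rfl fun k _ => ?_
  rw [Finset.sum_comm]
  refine Finset.sum_congr rfl fun l _ => ?_
  by_cases h : pentagonal k + pentagonal l = n
  · rw [Finset.sum_eq_single_of_mem (pentagonal k, pentagonal l)
      (Finset.HasAntidiagonal.mem_antidiagonal.2 h)]
    · simp only [and_true, if_pos h]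
      split_ifs <;> simp_all
    · rintro ⟨i, j⟩ _ hij
      simp only [ite_zero_mul_ite_zero]
      rw [if_neg]
      rintro ⟨⟨_, rfl⟩, _, rfl⟩
      exact hij rfl
  · rw [if_neg h, ite_self, Finset.sum_eq_zero]
    rintro ⟨i, j⟩ hij
    simp only [ite_zero_mul_ite_zero]
    rw [if_neg]
    rintro ⟨⟨_, rfl⟩, _, rfl⟩
    exact h (Finset.HasAntidiagonal.mem_antidiagonal.1 hij)

/-- With `a = 6 k - 1` and `b = 6 l - 1`, the condition on `k` and `l` reads `a ≡ 2 b` modulo `5`.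
The involution `(a, b) ↦ (-3 a - 4 b, -4 a + 3 b) / 5` of these pairs preserves `a ^ 2 + b ^ 2`,
which is `24 (pentagonal k + pentagonal l) + 2`, and changes the parity of `k + l`, so that all terms
cancel. -/
theorem sum_reflection_eq_zero (n : ℕ) :
    ∑ k ∈ Finset.Icc (-n : ℤ) n, ∑ l ∈ Finset.Icc (-n : ℤ) n,
      (if (5 : ℤ) ∣ k - 2 * l + 1 then
        (if pentagonal k + pentagonal l = n then
          ((k.negOnePow : ℤˣ) : ℤ) * ((l.negOnePow : ℤˣ) : ℤ) else 0) else 0) = 0 := by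
  rw [← Finset.sum_product', ← Finset.sum_filter, ← Finset.sum_filter]
  have key (k l : ℤ) (h5 : (5 : ℤ) ∣ k - 2 * l + 1) (hn : pentagonal k + pentagonal l = n) :
      (5 : ℤ) ∣ (2 - 3 * k - 4 * l) / 5 - 2 * ((1 - 4 * k + 3 * l) / 5) + 1 ∧
      pentagonal ((2 - 3 * k - 4 * l) / 5) + pentagonal ((1 - 4 * k + 3 * l) / 5) = n := by
    obtain ⟨t, ht⟩ := h5
    obtain rfl : k = 5 * t + 2 * l - 1 := by omega
    have e1 : (2 - 3 * (5 * t + 2 * l - 1) - 4 * l) / 5 = 1 - 3 * t - 2 * l := by omega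
    have e2 : (1 - 4 * (5 * t + 2 * l - 1) + 3 * l) / 5 = 1 - 4 * t - l := by omega
    rw [e1, e2]
    refine ⟨⟨t, by ring⟩, ?_⟩
    have h1 := two_mul_natCast_pentagonal (5 * t + 2 * l - 1)
    have h2 := two_mul_natCast_pentagonal l
    have h3 := two_mul_natCast_pentagonal (1 - 3 * t - 2 * l)
    have h4 := two_mul_natCast_pentagonal (1 - 4 * t - l)
    zify at hn ⊢
    linarith
  refine Finset.sum_involution
    (fun p _ => ((2 - 3 * p.1 - 4 * p.2) / 5, (1 - 4 * p.1 + 3 * p.2) / 5)) ?_ ?_ ?_ ?_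
  · rintro ⟨k, l⟩ h
    simp only [Finset.mem_filter] at h
    obtain ⟨⟨_, t, ht⟩, _⟩ := h
    simp only at ht ⊢
    obtain rfl : k = 5 * t + 2 * l - 1 := by omega
    have e1 : (2 - 3 * (5 * t + 2 * l - 1) - 4 * l) / 5 = 1 - 3 * t - 2 * l := by omega
    have e2 : (1 - 4 * (5 * t + 2 * l - 1) + 3 * l) / 5 = 1 - 4 * t - l := by omega
    rw [e1, e2, ← Units.val_mul, ← Units.val_mul, ← Int.negOnePow_add, ← Int.negOnePow_add]
    have : (1 - 3 * t - 2 * l + (1 - 4 * t - l)).negOnePow =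
        - (5 * t + 2 * l - 1 + l).negOnePow := by
      rw [← Int.negOnePow_succ, Int.negOnePow_eq_iff]
      exact ⟨1 - 6 * t - 3 * l, by ring⟩
    rw [this]
    simp
  · rintro ⟨k, l⟩ h _ he
    simp only [Finset.mem_filter] at h
    obtain ⟨⟨_, t, ht⟩, _⟩ := h
    simp only [Prod.mk.injEq] at he ht
    omega
  · rintro ⟨k, l⟩ h
    simp only [Finset.mem_filter] at h ⊢
    obtain ⟨h1, h2⟩ := key k l h.1.2 h.2
    have a1 := abs_le.1 ((abs_le_pentagonal _).trans
      (Int.ofNat_le.2 ((Nat.le_add_right _ _).trans h2.le)))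
    have a2 := abs_le.1 ((abs_le_pentagonal _).trans
      (Int.ofNat_le.2 ((Nat.le_add_left _ _).trans h2.le)))
    exact ⟨⟨Finset.mem_product.2 ⟨Finset.mem_Icc.2 a1, Finset.mem_Icc.2 a2⟩, h1⟩, h2⟩
  · rintro ⟨k, l⟩ h
    simp only [Finset.mem_filter] at h
    obtain ⟨⟨_, t, ht⟩, _⟩ := h
    simp only [Prod.mk.injEq] at ht ⊢
    omega

/-- If `x`, `y`, `z` are the parts of Euler's product with exponents `0`, `1`, `2` modulo `5`, then
`x * z = -y ^ 2`. The pairs that contribute to `x * z + y ^ 2` become those of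
`sum_reflection_eq_zero` when `k` and `l` are exchanged in half of the terms of `x * z`. -/
theorem classPart_zero_mul_classPart_two :
    classPart 5 0 𝓔 * classPart 5 2 𝓔 = -classPart 5 1 𝓔 ^ 2 := by
  rw [eq_neg_iff_add_eq_zero, sq]
  ext n
  rw [map_add, coeff_classPart_mul_classPart, coeff_classPart_mul_classPart, map_zero]
  set s := Finset.Icc (-n : ℤ) n
  set F : ℤ → ℤ → ℤ := fun k l => if pentagonal k + pentagonal l = n then
    ((k.negOnePow : ℤˣ) : ℤ) * ((l.negOnePow : ℤˣ) : ℤ) else 0 with hF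
  have hsymm (k l : ℤ) : F k l = F l k := by simp only [hF, add_comm, mul_comm]
  have hA : ∑ k ∈ s, ∑ l ∈ s, (if (5 : ℤ) ∣ k - 2 * l + 1 then F k l else 0) = 0 :=
    sum_reflection_eq_zero n
  have hswap : ∑ k ∈ s, ∑ l ∈ s, (if (k : ZMod 5) = 0 ∧ (l : ZMod 5) = 4 ∨
      (k : ZMod 5) = 2 ∧ (l : ZMod 5) = 3 then F k l else 0) =
      ∑ k ∈ s, ∑ l ∈ s, (if (l : ZMod 5) = 0 ∧ (k : ZMod 5) = 4 ∨
      (l : ZMod 5) = 2 ∧ (k : ZMod 5) = 3 then F k l else 0) := by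
    rw [Finset.sum_comm]
    simp only [hsymm]
  -- Modulo `5` the pairs in `x * z` are `(0, 3)`, `(2, 4)`, `(0, 4)`, `(2, 3)`, the one in `y * y`
  -- is `(1, 1)`, and those with `k ≡ 2 l - 1` are `(0, 3)`, `(2, 4)`, `(4, 0)`, `(3, 2)`, `(1, 1)`.
  have hmod : ∀ k l : ZMod 5,
      ((if 3 * k * (3 * k - 1) = 0 ∧ 3 * l * (3 * l - 1) = 2 then 1 else 0) +
        (if 3 * k * (3 * k - 1) = 1 ∧ 3 * l * (3 * l - 1) = 1 then 1 else 0) : ℤ) =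
      (if k - 2 * l + 1 = 0 then 1 else 0) +
        ((if k = 0 ∧ l = 4 ∨ k = 2 ∧ l = 3 then 1 else 0) -
          if l = 0 ∧ k = 4 ∨ l = 2 ∧ k = 3 then 1 else 0) := by
    decide
  have hpt (k l : ℤ) :
      (if ((pentagonal k : ℕ) : ZMod 5) = 0 ∧ ((pentagonal l : ℕ) : ZMod 5) = 2
        then F k l else 0) +
      (if ((pentagonal k : ℕ) : ZMod 5) = 1 ∧ ((pentagonal l : ℕ) : ZMod 5) = 1
        then F k l else 0) =
      (if (5 : ℤ) ∣ k - 2 * l + 1 then F k l else 0) +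
        ((if (k : ZMod 5) = 0 ∧ (l : ZMod 5) = 4 ∨ (k : ZMod 5) = 2 ∧ (l : ZMod 5) = 3
          then F k l else 0) -
        if (l : ZMod 5) = 0 ∧ (k : ZMod 5) = 4 ∨ (l : ZMod 5) = 2 ∧ (k : ZMod 5) = 3
          then F k l else 0) := by
    have h5 : (5 : ℤ) ∣ k - 2 * l + 1 ↔ (k : ZMod 5) - 2 * l + 1 = 0 := by
      have := ZMod.intCast_zmod_eq_zero_iff_dvd (k - 2 * l + 1) 5
      push_cast at this
      exact this.symm
    have := congrArg (· * F k l) (hmod k l)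
    simpa only [pentagonal_mod_five, h5, add_mul, sub_mul, ite_mul, one_mul, zero_mul] using this
  have hsum := Finset.sum_congr (rfl : s = s) fun k _ =>
    Finset.sum_congr (rfl : s = s) fun l _ => hpt k l
  simp only [Finset.sum_add_distrib, Finset.sum_sub_distrib] at hsum
  rw [hA, hswap, sub_self, add_zero] at hsum
  exact hsum

theorem pentagonalSeries_eq_classPart_add :
    𝓔 = classPart 5 0 𝓔 + classPart 5 1 𝓔 + classPart 5 2 𝓔 := by
  have hmod : ∀ k : ZMod 5, 3 * k * (3 * k - 1) = 0 ∨ 3 * k * (3 * k - 1) = 1 ∨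
    3 * k * (3 * k - 1) = 2 := by decide
  ext n
  simp only [map_add, coeff_classPart]
  by_cases hn : n ∈ Set.range pentagonal
  · obtain ⟨k, rfl⟩ := hn
    have h01 : (0 : ZMod 5) ≠ 1 := by decide
    have h02 : (0 : ZMod 5) ≠ 2 := by decide
    have h12 : (1 : ZMod 5) ≠ 2 := by decide
    rw [pentagonal_mod_five]
    rcases hmod k with h | h | h <;> rw [h] <;> simp [h01, h02, h12, h01.symm, h02.symm, h12.symm]
  · simp [coeff_pentagonalSeries_eq_zero ℤ hn]

/-- Pentagonal numbers congruent to `1` modulo `5` are congruent to `1` modulo `25`. -/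
theorem supportedOn_classPart_one : SupportedOn 25 1 (classPart 5 1 𝓔) := by
  have hmod : ∀ k : ZMod 25, 13 * k * (3 * k - 1) ≠ 1 →
      3 * (ZMod.castHom (by norm_num : 5 ∣ 25) (ZMod 5) k) *
        (3 * (ZMod.castHom (by norm_num : 5 ∣ 25) (ZMod 5) k) - 1) ≠ 1 := by decide
  intro n hn
  rw [coeff_classPart]
  split_ifs with h
  · refine coeff_pentagonalSeries_eq_zero ℤ ?_
    rintro ⟨k, rfl⟩
    have h2 := congrArg (Int.cast : ℤ → ZMod 25) (two_mul_natCast_pentagonal k)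
    push_cast at h2
    have h26 : (26 : ZMod 25) = 1 := rfl
    have h3 : ((pentagonal k : ℕ) : ZMod 25) = 13 * k * (3 * k - 1) := by
      linear_combination 13 * h2 - h26 * (pentagonal k : ZMod 25)
    rw [h3] at hn
    rw [pentagonal_mod_five] at h
    have := hmod k hn
    rw [map_intCast] at this
    exact this h
  · rfl

/-! ### Powers of Euler's product -/

/-- The part of the `N`-th power of Euler's product with exponents congruent to `N` modulo `5`. -/
noncomputable def powPart (N : ℕ) : ℤ⟦X⟧ := classPart 5 N (𝓔 ^ N)

/-- The norm of Euler's product from power series in `q` to power series in `q ^ 5`, written with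
the parts `x`, `y`, `z` of Euler's product as `x ^ 5 + 11 * y ^ 5 + z ^ 5`. -/
noncomputable def normSeries : ℤ⟦X⟧ :=
  classPart 5 0 𝓔 ^ 5 + 11 • classPart 5 1 𝓔 ^ 5 + classPart 5 2 𝓔 ^ 5

theorem supportedOn_normSeries : SupportedOn 5 0 normSeries := by
  have h (c : ZMod 5) : SupportedOn 5 0 (classPart 5 c 𝓔 ^ 5) := by
    have := (supportedOn_classPart c 𝓔).pow 5
    rwa [show ((5 : ℕ) : ZMod 5) = 0 from rfl, zero_mul] at this
  refine ((h 0).add fun n hn => ?_).add (h 2)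
  rw [map_nsmul, h 1 n hn, smul_zero]

/-- The quintic equation of Euler's product `E = x + y + z`, a consequence of `x * z = -y ^ 2`:
with `t = x + z` both sides equal `t ^ 5 + 5 t ^ 3 y ^ 2 + 5 t y ^ 4 + 11 y ^ 5`. -/
theorem normSeries_eq : normSeries = 𝓔 ^ 5 - 5 * classPart 5 1 𝓔 * 𝓔 ^ 4 +
    15 * classPart 5 1 𝓔 ^ 2 * 𝓔 ^ 3 - 25 * classPart 5 1 𝓔 ^ 3 * 𝓔 ^ 2 +
    25 * classPart 5 1 𝓔 ^ 4 * 𝓔 := by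
  have h := classPart_zero_mul_classPart_two
  have he := pentagonalSeries_eq_classPart_add
  rw [normSeries, nsmul_eq_mul]
  push_cast
  generalize classPart 5 0 𝓔 = x at *
  generalize classPart 5 1 𝓔 = y at *
  generalize classPart 5 2 𝓔 = z at *
  rw [he]
  linear_combination (-5 * (x + z) * ((x + z) ^ 2 + y ^ 2 - x * z)) * h

theorem classPart_pow_mul_pow (a b : ℕ) :
    classPart 5 ((a + b : ℕ) : ZMod 5) (classPart 5 1 𝓔 ^ a * 𝓔 ^ b) =
      classPart 5 1 𝓔 ^ a * powPart b := by
  have := (supportedOn_classPart (1 : ZMod 5) 𝓔).pow a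
  rw [mul_one] at this
  rw [Nat.cast_add, classPart_mul_left _ this, powPart]

/-- The quintic equation, multiplied by the `N`-th power of Euler's product and restricted to the
class of `N` modulo `5`. -/
theorem powPart_add_five (N : ℕ) :
    powPart (N + 5) = 5 * classPart 5 1 𝓔 * powPart (N + 4) -
      15 * classPart 5 1 𝓔 ^ 2 * powPart (N + 3) + 25 * classPart 5 1 𝓔 ^ 3 * powPart (N + 2) -
      25 * classPart 5 1 𝓔 ^ 4 * powPart (N + 1) + normSeries * powPart N := by
  have h : 𝓔 ^ (N + 5) = 5 • (classPart 5 1 𝓔 ^ 1 * 𝓔 ^ (N + 4)) -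
      15 • (classPart 5 1 𝓔 ^ 2 * 𝓔 ^ (N + 3)) + 25 • (classPart 5 1 𝓔 ^ 3 * 𝓔 ^ (N + 2)) -
      25 • (classPart 5 1 𝓔 ^ 4 * 𝓔 ^ (N + 1)) + normSeries * 𝓔 ^ N := by
    rw [normSeries_eq]
    simp only [nsmul_eq_mul]
    push_cast
    ring
  have h0 : classPart 5 ((N + 5 : ℕ) : ZMod 5) (normSeries * 𝓔 ^ N) = normSeries * powPart N := by
    rw [powPart, ← classPart_mul_left _ supportedOn_normSeries, zero_add, Nat.cast_add,
      show ((5 : ℕ) : ZMod 5) = 0 from rfl, add_zero]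
  have h1 := classPart_pow_mul_pow 1 (N + 4)
  have h2 := classPart_pow_mul_pow 2 (N + 3)
  have h3 := classPart_pow_mul_pow 3 (N + 2)
  have h4 := classPart_pow_mul_pow 4 (N + 1)
  rw [show 1 + (N + 4) = N + 5 by ring] at h1
  rw [show 2 + (N + 3) = N + 5 by ring] at h2
  rw [show 3 + (N + 2) = N + 5 by ring] at h3
  rw [show 4 + (N + 1) = N + 5 by ring] at h4
  rw [powPart, h]
  simp only [map_add, map_sub, map_nsmul, h0, h1, h2, h3, h4]
  simp only [nsmul_eq_mul]
  push_cast
  ring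

theorem classPart_pentagonalSeries_mul (d : ZMod 5) (f : ℤ⟦X⟧) :
    classPart 5 d (𝓔 * f) = classPart 5 0 𝓔 * classPart 5 d f +
      classPart 5 1 𝓔 * classPart 5 (d - 1) f + classPart 5 2 𝓔 * classPart 5 (d - 2) f := by
  conv_lhs => rw [pentagonalSeries_eq_classPart_add, add_mul, add_mul, map_add, map_add]
  rw [← classPart_mul_left _ (supportedOn_classPart 0 𝓔),
    ← classPart_mul_left _ (supportedOn_classPart 1 𝓔),
    ← classPart_mul_left _ (supportedOn_classPart 2 𝓔), zero_add, add_sub_cancel, add_sub_cancel]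

theorem powPart_of_lt_five : powPart 0 = 1 ∧ powPart 1 = classPart 5 1 𝓔 ∧
    powPart 2 = -classPart 5 1 𝓔 ^ 2 ∧ powPart 3 = -5 * classPart 5 1 𝓔 ^ 3 ∧
    powPart 4 = -5 * classPart 5 1 𝓔 ^ 4 := by
  have h := classPart_zero_mul_classPart_two
  have e0 : classPart 5 0 1 = 1 := (supportedOn_one 5).classPart_eq
  have e1 : classPart 5 1 1 = 0 := (supportedOn_one 5).classPart_eq_zero (by decide)
  have e2 : classPart 5 2 1 = 0 := (supportedOn_one 5).classPart_eq_zero (by decide)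
  have e3 : classPart 5 3 1 = 0 := (supportedOn_one 5).classPart_eq_zero (by decide)
  have e4 : classPart 5 4 1 = 0 := (supportedOn_one 5).classPart_eq_zero (by decide)
  have c0 (f : ℤ⟦X⟧) := classPart_pentagonalSeries_mul 0 f
  have c1 (f : ℤ⟦X⟧) := classPart_pentagonalSeries_mul 1 f
  have c2 (f : ℤ⟦X⟧) := classPart_pentagonalSeries_mul 2 f
  have c3 (f : ℤ⟦X⟧) := classPart_pentagonalSeries_mul 3 f
  have c4 (f : ℤ⟦X⟧) := classPart_pentagonalSeries_mul 4 f
  rw [show (0 - 1 : ZMod 5) = 4 from rfl, show (0 - 2 : ZMod 5) = 3 from rfl] at c0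
  rw [show (1 - 1 : ZMod 5) = 0 from rfl, show (1 - 2 : ZMod 5) = 4 from rfl] at c1
  rw [show (2 - 1 : ZMod 5) = 1 from rfl, show (2 - 2 : ZMod 5) = 0 from rfl] at c2
  rw [show (3 - 1 : ZMod 5) = 2 from rfl, show (3 - 2 : ZMod 5) = 1 from rfl] at c3
  rw [show (4 - 1 : ZMod 5) = 3 from rfl, show (4 - 2 : ZMod 5) = 2 from rfl] at c4
  -- All class parts of the powers of `x + y + z` are expanded, and then `x * z = -y ^ 2` is used.
  have hc (N : ℕ) : powPart N = classPart 5 (N : ZMod 5) (𝓔 ^ N) := rfl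
  simp only [hc, Nat.cast_zero, Nat.cast_one, Nat.cast_ofNat]
  generalize classPart 5 0 𝓔 = x at *
  generalize classPart 5 1 𝓔 = y at *
  generalize classPart 5 2 𝓔 = z at *
  refine ⟨?_, ?_, ?_, ?_, ?_⟩ <;>
    simp only [pow_succ' 𝓔, pow_zero, c0, c1, c2, c3, c4, e0, e1, e2, e3, e4]
  · ring
  · linear_combination 2 * h
  · linear_combination 6 * y * h
  · linear_combination (12 * y ^ 2 + 6 * (x * z - y ^ 2)) * h

/-- The terms of the recurrence for `powPart` that matter: modulo `25` each of them is a multiple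
of a single monomial in `v` and `y`, and even of `5` times that monomial. -/
theorem recurrence_mod_twentyFive {R : Type*} [CommRing R] (b : ℕ → R) (v y : R)
    (h0 : b 0 = 1) (h1 : b 1 = y) (h2 : b 2 = -y ^ 2) (h3 : b 3 = -5 * y ^ 3)
    (h4 : b 4 = -5 * y ^ 4)
    (rec : ∀ N, b (N + 5) = 5 * y * b (N + 4) - 15 * y ^ 2 * b (N + 3) +
      25 * y ^ 3 * b (N + 2) - 25 * y ^ 4 * b (N + 1) + v * b N) :
    25 ∣ b 8 ∧ 25 ∣ b 14 ∧ 25 ∣ b 18 - 5 * (2 * v ^ 3 * y ^ 3) ∧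
      25 ∣ b 19 - 5 * (3 * v ^ 3 * y ^ 4) ∧ 25 ∣ b 23 - 5 * (3 * v ^ 4 * y ^ 3) ∧
      25 ∣ b 24 - 5 * (v ^ 4 * y ^ 4) := by
  have h5 : b 5 = v := by
    rw [rec 0, h4, h3, h2, h1, h0]
    ring
  have h6 : b 6 = 6 * v * y - 25 * y ^ 6 := by
    rw [rec 1, h5, h4, h3, h2, h1]
    ring
  have h7 : b 7 = 14 * v * y ^ 2 - 125 * y ^ 7 := by
    rw [rec 2, h6, h5, h4, h3, h2]
    ring
  have h8 : b 8 = -125 * y ^ 8 := by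
    rw [rec 3, h7, h6, h5, h4, h3]
    ring
  have h9 : b 9 = -90 * v * y ^ 4 + 625 * y ^ 9 := by
    rw [rec 4, h8, h7, h6, h5, h4]
    ring
  have h10 : b 10 = v ^ 2 - 250 * v * y ^ 5 + 2500 * y ^ 10 := by
    rw [rec 5, h9, h8, h7, h6, h5]
    ring
  have h11 : b 11 = 11 * v ^ 2 * y - 275 * v * y ^ 6 + 3125 * y ^ 11 := by
    rw [rec 6, h10, h9, h8, h7, h6]
    ring
  have h12 : b 12 = 54 * v ^ 2 * y ^ 2 - 3125 * y ^ 12 := by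
    rw [rec 7, h11, h10, h9, h8, h7]
    ring
  have h13 : b 13 = 130 * v ^ 2 * y ^ 3 - 15625 * y ^ 13 := by
    rw [rec 8, h12, h11, h10, h9, h8]
    ring
  have h14 : b 14 = -15625 * y ^ 14 := by
    rw [rec 9, h13, h12, h11, h10, h9]
    ring
  have h15 : b 15 = v ^ 3 - 1125 * v ^ 2 * y ^ 5 + 9375 * v * y ^ 10 := by
    rw [rec 10, h14, h13, h12, h11, h10]
    ring
  have h16 : b 16 =
      16 * v ^ 3 * y - 4000 * v ^ 2 * y ^ 6 + 50000 * v * y ^ 11 - 78125 * y ^ 16 := by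
    rw [rec 11, h15, h14, h13, h12, h11]
    ring
  have h17 : b 17 =
      119 * v ^ 3 * y ^ 2 - 6375 * v ^ 2 * y ^ 7 + 106250 * v * y ^ 12 - 390625 * y ^ 17 := by
    rw [rec 12, h16, h15, h14, h13, h12]
    ring
  have h18 : b 18 = 510 * v ^ 3 * y ^ 3 - 390625 * y ^ 18 := by
    rw [rec 13, h17, h16, h15, h14, h13]
    ring
  have h19 : b 19 =
      1140 * v ^ 3 * y ^ 4 + 23750 * v ^ 2 * y ^ 9 - 593750 * v * y ^ 14 + 1953125 * y ^ 19 := by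
    rw [rec 14, h18, h17, h16, h15, h14]
    ring
  have h20 : b 20 =
      v ^ 4 - 500 * v ^ 3 * y ^ 5 + 68750 * v ^ 2 * y ^ 10 - 1562500 * v * y ^ 15 +
        7812500 * y ^ 20 := by
    rw [rec 15, h19, h18, h17, h16, h15]
    ring
  have h21 : b 21 =
      21 * v ^ 4 * y - 13825 * v ^ 3 * y ^ 6 + 196875 * v ^ 2 * y ^ 11 -
        1640625 * v * y ^ 16 + 9765625 * y ^ 21 := by
    rw [rec 16, h20, h19, h18, h17, h16]
    ring
  have h22 : b 22 =
      209 * v ^ 4 * y ^ 2 - 52250 * v ^ 3 * y ^ 7 + 653125 * v ^ 2 * y ^ 12 -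
        9765625 * y ^ 22 := by
    rw [rec 17, h21, h20, h19, h18, h17]
    ring
  have h23 : b 23 =
      1265 * v ^ 4 * y ^ 3 - 94875 * v ^ 3 * y ^ 8 + 1437500 * v ^ 2 * y ^ 13 -
        48828125 * y ^ 23 := by
    rw [rec 18, h22, h21, h20, h19, h18]
    ring
  have h24 : b 24 = 4830 * v ^ 4 * y ^ 4 - 48828125 * y ^ 24 := by
    rw [rec 19, h23, h22, h21, h20, h19]
    ring
  rw [h8, h14, h18, h19, h23, h24]
  refine ⟨⟨-5 * y ^ 8, by ring⟩, ⟨-625 * y ^ 14, by ring⟩,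
    ⟨20 * v ^ 3 * y ^ 3 - 15625 * y ^ 18, by ring⟩,
    ⟨45 * v ^ 3 * y ^ 4 + 950 * v ^ 2 * y ^ 9 - 23750 * v * y ^ 14 + 78125 * y ^ 19, by ring⟩,
    ⟨50 * v ^ 4 * y ^ 3 - 3795 * v ^ 3 * y ^ 8 + 57500 * v ^ 2 * y ^ 13 - 1953125 * y ^ 23,
      by ring⟩,
    ⟨193 * v ^ 4 * y ^ 4 - 1953125 * y ^ 24, by ring⟩⟩

theorem powPart_mod_twentyFive :
    25 ∣ powPart 8 ∧ 25 ∣ powPart 14 ∧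
      25 ∣ powPart 18 - 5 * (2 * normSeries ^ 3 * classPart 5 1 𝓔 ^ 3) ∧
      25 ∣ powPart 19 - 5 * (3 * normSeries ^ 3 * classPart 5 1 𝓔 ^ 4) ∧
      25 ∣ powPart 23 - 5 * (3 * normSeries ^ 4 * classPart 5 1 𝓔 ^ 3) ∧
      25 ∣ powPart 24 - 5 * (normSeries ^ 4 * classPart 5 1 𝓔 ^ 4) := by
  obtain ⟨h0, h1, h2, h3, h4⟩ := powPart_of_lt_five
  exact recurrence_mod_twentyFive powPart normSeries (classPart 5 1 𝓔) h0 h1 h2 h3 h4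
    powPart_add_five

/-! ### Divisibility of coefficients -/

/-- Only the class part of a power of Euler's product matters for the coefficients in that class
of its product with a power series in `q ^ 5`. -/
theorem coeff_mul_pow_eq {n N : ℕ} (h : n ≡ N [MOD 5]) {g : ℤ⟦X⟧} (hg : SupportedOn 5 0 g) :
    coeff n (g * 𝓔 ^ N) = coeff n (g * powPart N) := by
  have hn : (n : ZMod 5) = N := (ZMod.natCast_eq_natCast_iff n N 5).2 h
  rw [powPart, ← classPart_mul_left _ hg, zero_add, ← hn, coeff_classPart_self]

instance fact_prime_five : Fact (Nat.Prime 5) := ⟨by norm_num⟩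

/-- Modulo `25`, the generating function of `(25 r + k)`-colored partitions is the product of the
`(25 - k)`-th power of Euler's product and a power series in `q ^ 5`. -/
theorem dvd_coloredSeries_sub {k N : ℕ} (hk : k + N = 25) (r : ℕ) :
    (25 : ℤ⟦X⟧) ∣ coloredSeries (25 * r + k) -
      expand 5 (by norm_num) (coloredSeries 1 ^ (5 * (r + 1))) * 𝓔 ^ N := by
  set F := expand 5 (by norm_num) 𝓔 with hF
  set G := expand 5 (by norm_num) (coloredSeries 1 ^ (5 * (r + 1))) with hG
  set P := coloredSeries (25 * r + k)
  have hGF : G * F ^ (5 * (r + 1)) = 1 := by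
    have h := coloredSeries_mul_pow 1
    rw [pow_one] at h
    rw [hG, hF, ← map_pow, ← map_mul, ← mul_pow, h, one_pow, map_one]
  have hP : P * 𝓔 ^ (25 * r + k) = 1 := coloredSeries_mul_pow _
  have h25 : (25 : ℤ⟦X⟧) ∣ 𝓔 ^ 25 - F ^ 5 := by
    have := dvd_sub_pow_of_dvd_sub (natCast_dvd_pow_sub_expand 5 𝓔) 1
    norm_num [← pow_mul] at this
    exact this
  have h := (h25.trans (sub_dvd_pow_sub_pow _ _ (r + 1))).mul_left (-(P * G))
  convert h using 1
  rw [← pow_mul, ← pow_mul, show 25 * (r + 1) = 25 * r + k + N by omega, pow_add]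
  linear_combination (-P) * hGF + G * 𝓔 ^ N * hP

theorem dvd_numColored_of_dvd_powPart {k N : ℕ} (hk : k + N = 25) (h : 25 ∣ powPart N) (r n : ℕ)
    (hn : n ≡ N [MOD 5]) : numColored (25 * r + k) n ≡ 0 [MOD 25] := by
  rw [Nat.modEq_zero_iff_dvd, ← Int.natCast_dvd_natCast]
  have h1 := dvd_coeff_of_natCast_dvd (m := 25) (dvd_coloredSeries_sub hk r) n
  have h2 := dvd_coeff_of_natCast_dvd (m := 25)
    (h.mul_left (expand 5 (by norm_num) (coloredSeries 1 ^ (5 * (r + 1))))) n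
  rw [map_sub, coeff_mul_pow_eq hn (supportedOn_expand _ _), coloredSeries, coeff_mk] at h1
  exact (dvd_sub_left h2).1 h1

theorem dvd_normSeries_sub_expand : (5 : ℤ⟦X⟧) ∣ normSeries - expand 5 (by norm_num) 𝓔 := by
  have h : (5 : ℤ⟦X⟧) ∣ 𝓔 ^ 5 - expand 5 (by norm_num) 𝓔 := natCast_dvd_pow_sub_expand 5 𝓔
  rw [normSeries_eq]
  obtain ⟨t, ht⟩ := h
  exact ⟨t - classPart 5 1 𝓔 * 𝓔 ^ 4 + 3 * classPart 5 1 𝓔 ^ 2 * 𝓔 ^ 3 -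
    5 * classPart 5 1 𝓔 ^ 3 * 𝓔 ^ 2 + 5 * classPart 5 1 𝓔 ^ 4 * 𝓔, by linear_combination ht⟩

theorem dvd_coeff_mul_expand {f h : ℤ⟦X⟧} {i j n : ℕ} (hf : SupportedOn 25 j f)
    (hh : ∀ m, m ≡ i [MOD 5] → 5 ∣ coeff m h) (hn : n ≡ 5 * i + j [MOD 25]) :
    5 ∣ coeff n (f * expand 5 (by norm_num) h) := by
  rw [coeff_mul]
  refine Finset.dvd_sum ?_
  rintro ⟨a, b⟩ hab
  replace hab := Finset.HasAntidiagonal.mem_antidiagonal.1 hab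
  dsimp only at hab ⊢
  by_cases ha : (a : ZMod 25) = j
  · rw [coeff_expand]
    split_ifs with hb
    · obtain ⟨m, rfl⟩ := hb
      have := (ZMod.natCast_eq_natCast_iff a j 25).1 ha
      refine (hh _ ?_).mul_left _
      unfold Nat.ModEq at *
      omega
    · simp
  · rw [hf a ha, zero_mul]
    exact dvd_zero _

/-- Modulo `5` the left factor is a power series in `q ^ 25`, and `normSeries` is Euler's product in
`q ^ 5`, so that the coefficient comes from the class of `i` modulo `5` in the `i`-th power of
Euler's product. -/
theorem dvd_coeff_expand_mul_normSeries {i j n : ℕ} (hi : 5 ∣ powPart i)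
    (hn : n ≡ 5 * i + j [MOD 25]) (r : ℕ) :
    5 ∣ coeff n (expand 5 (by norm_num) (coloredSeries 1 ^ (5 * (r + 1))) *
      (normSeries ^ i * classPart 5 1 𝓔 ^ j)) := by
  set Q := coloredSeries 1
  set W := expand 5 (by norm_num) (Q ^ (r + 1)) with hW
  have hV : (5 : ℤ⟦X⟧) ∣ normSeries ^ i - expand 5 (by norm_num) (𝓔 ^ i) := by
    rw [map_pow]
    exact dvd_normSeries_sub_expand.trans (sub_dvd_pow_sub_pow _ _ i)
  have hQ : (5 : ℤ⟦X⟧) ∣ expand 5 (by norm_num) (Q ^ (5 * (r + 1))) -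
      expand 5 (by norm_num) W := by
    have h : (5 : ℤ⟦X⟧) ∣ Q ^ 5 - expand 5 (by norm_num) Q := natCast_dvd_pow_sub_expand 5 Q
    have h' := map_dvd (expand 5 (by norm_num) : ℤ⟦X⟧ →ₐ[ℤ] ℤ⟦X⟧)
      (h.trans (sub_dvd_pow_sub_pow _ _ (r + 1)))
    rwa [map_sub, map_ofNat, ← pow_mul, ← map_pow] at h'
  have hY : SupportedOn 25 j (classPart 5 1 𝓔 ^ j) := by
    have := supportedOn_classPart_one.pow j
    rwa [mul_one] at this
  have hcoeff : ∀ m, m ≡ i [MOD 5] → (5 : ℤ) ∣ coeff m (W * 𝓔 ^ i) := by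
    intro m hm
    rw [coeff_mul_pow_eq hm (supportedOn_expand _ _)]
    exact dvd_coeff_of_natCast_dvd (m := 5) (hi.mul_left W) m
  have h1 := dvd_coeff_mul_expand hY hcoeff hn
  set G := expand 5 (by norm_num) (Q ^ (5 * (r + 1)))
  have h2 : (5 : ℤ⟦X⟧) ∣ G * (normSeries ^ i * classPart 5 1 𝓔 ^ j) -
      classPart 5 1 𝓔 ^ j * expand 5 (by norm_num) (W * 𝓔 ^ i) := by
    rw [map_mul]
    convert ((hV.mul_left G).add (hQ.mul_right (expand 5 (by norm_num) (𝓔 ^ i)))).mul_right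
      (classPart 5 1 𝓔 ^ j) using 1
    ring
  have h3 := dvd_coeff_of_natCast_dvd (m := 5) h2 n
  rw [map_sub] at h3
  exact (dvd_sub_left h1).1 h3

theorem dvd_numColored_of_dvd_powPart_sub {k N i j c : ℕ} (hk : k + N = 25) (hN : 5 * i + j = N)
    (h : 25 ∣ powPart N - 5 * (c * normSeries ^ i * classPart 5 1 𝓔 ^ j)) (hi : 5 ∣ powPart i)
    (r n : ℕ) : numColored (25 * r + k) (25 * n + 25 - k) ≡ 0 [MOD 25] := by
  rw [Nat.modEq_zero_iff_dvd, ← Int.natCast_dvd_natCast]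
  set n' := 25 * n + 25 - k with hn'
  have hn5 : n' ≡ N [MOD 5] := by unfold Nat.ModEq; omega
  have hn25 : n' ≡ 5 * i + j [MOD 25] := by unfold Nat.ModEq; omega
  have h1 := dvd_coeff_of_natCast_dvd (m := 25) (dvd_coloredSeries_sub hk r) n'
  rw [map_sub, coeff_mul_pow_eq hn5 (supportedOn_expand _ _), coloredSeries, coeff_mk] at h1
  obtain ⟨t, ht⟩ := dvd_coeff_expand_mul_normSeries hi hn25 r
  set G := expand 5 (by norm_num) (coloredSeries 1 ^ (5 * (r + 1)))
  have h3 := dvd_coeff_of_natCast_dvd (m := 25) (h.mul_left G) n'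
  have h4 : G * (powPart N - 5 * (c * normSeries ^ i * classPart 5 1 𝓔 ^ j)) =
      G * powPart N - (5 * c) • (G * (normSeries ^ i * classPart 5 1 𝓔 ^ j)) := by
    rw [nsmul_eq_mul]
    push_cast
    ring
  rw [h4, map_sub, map_nsmul, nsmul_eq_mul, ht] at h3
  have h5 : ((5 * c : ℕ) : ℤ) * (5 * t) = 25 * (c * t) := by
    push_cast
    ring
  rw [h5] at h3
  push_cast at h1 h3 ⊢
  omega

theorem theorem1p1 :
    (∀ r : ℕ, ∀ k ∈ ({1, 2, 6, 7, 11, 17} : Set ℕ), ∀ n : ℕ,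
      numColored (25 * r + k) (25 * n + 25 - k) ≡ 0 [MOD 25]) ∧
    (∀ n : ℕ, numColored 17 (5 * n + 3) ≡ 0 [MOD 25]) ∧
    (∀ n : ℕ, numColored 11 (5 * n + 4) ≡ 0 [MOD 25]) := by
  obtain ⟨h8, h14, h18, h19, h23, h24⟩ := powPart_mod_twentyFive
  obtain ⟨_, _, _, h3, h4⟩ := powPart_of_lt_five
  have d3 : 5 ∣ powPart 3 := ⟨-classPart 5 1 𝓔 ^ 3, by rw [h3]; ring⟩
  have d4 : 5 ∣ powPart 4 := ⟨-classPart 5 1 𝓔 ^ 4, by rw [h4]; ring⟩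
  refine ⟨?_, fun n => ?_, fun n => ?_⟩
  · intro r k hk n
    simp only [Set.mem_insert_iff, Set.mem_singleton_iff] at hk
    rcases hk with rfl | rfl | rfl | rfl | rfl | rfl
    · exact dvd_numColored_of_dvd_powPart_sub (i := 4) (j := 4) (c := 1) rfl rfl
        (by simpa using h24) d4 r n
    · exact dvd_numColored_of_dvd_powPart_sub (i := 4) (j := 3) (c := 3) rfl rfl
        (by simpa using h23) d4 r n
    · exact dvd_numColored_of_dvd_powPart_sub (i := 3) (j := 4) (c := 3) rfl rfl
        (by simpa using h19) d3 r n
    · exact dvd_numColored_of_dvd_powPart_sub (i := 3) (j := 3) (c := 2) rfl rfl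
        (by simpa using h18) d3 r n
    · exact dvd_numColored_of_dvd_powPart rfl h14 r _ (by unfold Nat.ModEq; omega)
    · exact dvd_numColored_of_dvd_powPart rfl h8 r _ (by unfold Nat.ModEq; omega)
  · exact dvd_numColored_of_dvd_powPart rfl h8 0 (5 * n + 3) (by unfold Nat.ModEq; omega)
  · exact dvd_numColored_of_dvd_powPart rfl h14 0 (5 * n + 4) (by unfold Nat.ModEq; omega)
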